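/- Let $k$ be a field with $\operatorname{char} k\neq 2$ and let $n\ge 0$. Let $E(n)$ be the Hopf algebra over $k$ generated by $g,x_1,\dots,x_n$ with relations $g^2=1$, $x_i^2=0$, $gx_i=-x_ig$, $x_ix_j=-x_jx_i$, and with $\Delta(g)=g\otimes g$, $\Delta(x_i)=x_i\otimes g+1\otimes x_i$, $\varepsilon(g)=1$, $\varepsilon(x_i)=0$, $S(g)=g$, $S(x_i)=gx_i$. Let $A$ be a finite-dimensional (associative, unital) $k$-algebra and let $\rho:A\to A\otimes E(n)$ be a coaction, i.e. a $k$-linear map making $A$ a right $E(n)$-comodule algebra. Then there is exactly one tuple $(\varphi,d_1,\dots,d_n)$, called the tuple associated to $\rho$, such that $\varphi:A\to A$ is an algebra endomorphism with $\varphi^2=\mathrm{Id}_A$, each $d_i:A\to A$ is $k$-linear with $d_i(ab)=d_i(a)b+\varphi(a)d_i(b)$ for all $a,b\in A$, $d_i^2=0$, $\varphi d_i=-d_i\varphi$, $d_id_j=-d_jd_i$ for all $i,j$, and for every $a\in A$ $$\rho(a)=\sum_{P\subseteq\{1,\dots,n\}}(-1)^{\lfloor\frac{|P|+1}{2}\rfloor}\left[d_P(a)\otimes\frac{x_P+(-1)^{|P|}gx_P}{2}+\varphi(d_P(a))\otimes\frac{x_P+(-1)^{|P|+1}gx_P}{2}\right],$$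 where for $P=\{i_1<\dots<i_s\}$ we put $x_P=x_{i_1}\cdots x_{i_s}$, $d_P=d_{i_1}\cdots d_{i_s}$ (composition), $x_\emptyset=1$, $d_\emptyset=\mathrm{Id}_A$. Moreover, for this tuple the space of coinvariants $A^{co\,E(n)}=\{a\in A \mid \rho(a)=a\otimes 1\}$ is $$A^{co\,E(n)}=\ker(\varphi-\mathrm{Id}_A)\cap\bigcap_{i=1}^n\ker d_i .$$ -/

import Mathlib

open scoped TensorProduct

/-! ### The Hopf algebra `E(n)` -/

/-- The generators `g, x_1, …, x_n` of `E(n)`. -/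
inductive ENGen (n : ℕ) : Type
  | g : ENGen n
  | x : Fin n → ENGen n

/-- The defining relations of `E(n)`:
`g² = 1`, `x_i² = 0`, `g x_i = - x_i g`, `x_i x_j = - x_j x_i`. -/
inductive ENRel (k : Type*) [Field k] (n : ℕ) :
    FreeAlgebra k (ENGen n) → FreeAlgebra k (ENGen n) → Prop
  | g_sq : ENRel k n (FreeAlgebra.ι k ENGen.g * FreeAlgebra.ι k ENGen.g) 1
  | x_sq (i : Fin n) :
      ENRel k n (FreeAlgebra.ι k (ENGen.x i) * FreeAlgebra.ι k (ENGen.x i)) 0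
  | g_x (i : Fin n) :
      ENRel k n (FreeAlgebra.ι k ENGen.g * FreeAlgebra.ι k (ENGen.x i))
        (-(FreeAlgebra.ι k (ENGen.x i) * FreeAlgebra.ι k ENGen.g))
  | x_x (i j : Fin n) (h : i < j) :
      ENRel k n (FreeAlgebra.ι k (ENGen.x i) * FreeAlgebra.ι k (ENGen.x j))
        (-(FreeAlgebra.ι k (ENGen.x j) * FreeAlgebra.ι k (ENGen.x i)))

/-- The algebra `E(n)` over `k`, presented by generators and relations. -/
def EN (k : Type*) [Field k] (n : ℕ) : Type _ := RingQuot (ENRel k n)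

namespace EN

variable (k : Type*) [Field k] (n : ℕ)

noncomputable instance : Ring (EN k n) := inferInstanceAs (Ring (RingQuot (ENRel k n)))

noncomputable instance instAlgebra : Algebra k (EN k n) :=
  inferInstanceAs (Algebra k (RingQuot (ENRel k n)))

/-- The canonical projection from the free algebra. -/
noncomputable def mk : FreeAlgebra k (ENGen n) →ₐ[k] EN k n := RingQuot.mkAlgHom k (ENRel k n)

/-- The generator `g` of `E(n)`. -/
noncomputable def g : EN k n := mk k n (FreeAlgebra.ι k ENGen.g)

variable {n} in
/-- The generator `x_i` of `E(n)`. -/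
noncomputable def x (i : Fin n) : EN k n := mk k n (FreeAlgebra.ι k (ENGen.x i))

variable {k n}

lemma mk_rel {a b : FreeAlgebra k (ENGen n)} (h : ENRel k n a b) : mk k n a = mk k n b :=
  RingQuot.mkAlgHom_rel k h

lemma g_mul_g : g k n * g k n = 1 := by
  simpa [g] using mk_rel (ENRel.g_sq (k := k) (n := n))

lemma x_mul_x (i : Fin n) : x k i * x k i = 0 := by
  simpa [x] using mk_rel (ENRel.x_sq (k := k) i)

lemma g_mul_x (i : Fin n) : g k n * x k i = -(x k i * g k n) := by
  simpa [x, g] using mk_rel (ENRel.g_x (k := k) i)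

lemma x_mul_x' (i j : Fin n) : x k i * x k j = -(x k j * x k i) := by
  rcases lt_trichotomy i j with h | rfl | h
  · simpa [x] using mk_rel (ENRel.x_x (k := k) i j h)
  · simp [x_mul_x]
  · rw [eq_comm, neg_eq_iff_eq_neg]
    simpa [x] using mk_rel (ENRel.x_x (k := k) j i h)

/-- The universal property of `E(n)`. -/
noncomputable def lift {B : Type*} [Ring B] [Algebra k B] (G : B) (X : Fin n → B)
    (hG : G * G = 1) (hX : ∀ i, X i * X i = 0) (hGX : ∀ i, G * X i = -(X i * G))
    (hXX : ∀ i j, i < j → X i * X j = -(X j * X i)) : EN k n →ₐ[k] B :=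
  RingQuot.liftAlgHom k
    ⟨FreeAlgebra.lift k (fun s => match s with
      | ENGen.g => G
      | ENGen.x i => X i), by
      intro a b h
      induction h with
      | g_sq => simp [hG]
      | x_sq i => simp [hX]
      | g_x i => simp [hGX]
      | x_x i j h => simp [hXX i j h]⟩

section lift
variable {B : Type*} [Ring B] [Algebra k B] (G : B) (X : Fin n → B)
    (hG : G * G = 1) (hX : ∀ i, X i * X i = 0) (hGX : ∀ i, G * X i = -(X i * G))
    (hXX : ∀ i j, i < j → X i * X j = -(X j * X i))

@[simp] lemma lift_g : lift G X hG hX hGX hXX (g k n) = G := by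
  refine (RingQuot.liftAlgHom_mkAlgHom_apply k _ _ _).trans ?_
  simp

@[simp] lemma lift_x (i : Fin n) : lift G X hG hX hGX hXX (x k i) = X i := by
  refine (RingQuot.liftAlgHom_mkAlgHom_apply k _ _ _).trans ?_
  simp

end lift

lemma algHom_ext {B : Type*} [Semiring B] [Algebra k B] {F F' : EN k n →ₐ[k] B}
    (hg : F (g k n) = F' (g k n)) (hx : ∀ i, F (x k i) = F' (x k i)) : F = F' := by
  refine RingQuot.ringQuot_ext' k F F' ?_
  refine FreeAlgebra.hom_ext ?_
  funext s
  cases s with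
  | g => exact hg
  | x i => exact hx i

lemma induction {p : EN k n → Prop} (h1 : p 1) (hg : ∀ a, p a → p (a * g k n))
    (hx : ∀ i a, p a → p (a * x k i)) (hadd : ∀ a b, p a → p b → p (a + b))
    (hsmul : ∀ (c : k) a, p a → p (c • a)) (a : EN k n) : p a := by
  obtain ⟨b, rfl⟩ : ∃ b, mk k n b = a := RingQuot.mkAlgHom_surjective k (ENRel k n) a
  have key : ∀ c, p c → p (c * mk k n b) := by
    induction b using FreeAlgebra.induction with
    | grade0 r =>
      intro c hc
      rw [AlgHom.commutes, ← Algebra.commutes, ← Algebra.smul_def]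
      exact hsmul r c hc
    | grade1 s =>
      intro c hc
      cases s with
      | g => exact hg c hc
      | x i => exact hx i c hc
    | mul a b ha hb =>
      intro c hc
      rw [map_mul, ← mul_assoc]
      exact hb _ (ha c hc)
    | add a b ha hb =>
      intro c hc
      rw [map_add, mul_add]
      exact hadd _ _ (ha c hc) (hb c hc)
  simpa using key 1 h1

variable (k n)

/-- `Δ(g) = g ⊗ g`, `Δ(x_i) = x_i ⊗ g + 1 ⊗ x_i`, extended as an algebra map. -/
noncomputable def comulHom : EN k n →ₐ[k] EN k n ⊗[k] EN k n :=
  lift (g k n ⊗ₜ g k n) (fun i => x k i ⊗ₜ g k n + 1 ⊗ₜ x k i)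
    (by simp [g_mul_g, Algebra.TensorProduct.one_def])
    (by
      intro i
      simp [mul_add, add_mul, x_mul_x, g_mul_x, TensorProduct.tmul_neg])
    (by
      intro i
      simp [mul_add, add_mul, g_mul_g, g_mul_x, TensorProduct.tmul_neg, TensorProduct.neg_tmul]
      abel)
    (by
      intro i j _
      simp [mul_add, add_mul, g_mul_g, g_mul_x, x_mul_x' i j, TensorProduct.tmul_neg,
        TensorProduct.neg_tmul]
      abel)

/-- `ε(g) = 1`, `ε(x_i) = 0`, extended as an algebra map. -/
noncomputable def counitHom : EN k n →ₐ[k] k :=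
  lift 1 (fun _ => 0) (by simp) (by simp) (by simp) (by simp)

/-- `S(g) = g`, `S(x_i) = g x_i`, extended as an algebra map to the opposite algebra. -/
noncomputable def antipodeHom : EN k n →ₐ[k] (EN k n)ᵐᵒᵖ :=
  lift (MulOpposite.op (g k n)) (fun i => MulOpposite.op (g k n * x k i))
    (by rw [← MulOpposite.op_mul, g_mul_g, MulOpposite.op_one])
    (by
      intro i
      rw [← MulOpposite.op_mul, ← MulOpposite.op_zero]
      congr 1
      rw [g_mul_x, neg_mul_neg, mul_assoc, ← mul_assoc (g k n), g_mul_x, neg_mul, mul_neg,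
        ← mul_assoc, ← mul_assoc, x_mul_x]
      simp)
    (by
      intro i
      rw [← MulOpposite.op_mul, ← MulOpposite.op_mul, ← MulOpposite.op_neg]
      congr 1
      rw [g_mul_x i, neg_mul, mul_assoc, g_mul_g, mul_neg, ← mul_assoc, mul_assoc, mul_one,
        ← mul_neg, ← g_mul_x, ← mul_assoc, g_mul_g, one_mul])
    (by
      intro i j _
      rw [← MulOpposite.op_mul, ← MulOpposite.op_mul, ← MulOpposite.op_neg]
      congr 1
      have key : ∀ a b : Fin n, g k n * x k a * (g k n * x k b) = -(x k a * x k b) := by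
        intro a b
        rw [g_mul_x a, neg_mul, mul_assoc, ← mul_assoc (g k n) (g k n), g_mul_g, one_mul]
      rw [key, key, x_mul_x' j i])

/-- The bialgebra structure of `E(n)`. -/
noncomputable instance instBialgebra : Bialgebra k (EN k n) :=
  Bialgebra.ofAlgHom (comulHom k n) (counitHom k n)
    (by
      apply algHom_ext
      · simp [comulHom]
      · intro i
        simp [comulHom, TensorProduct.add_tmul, TensorProduct.tmul_add,
          Algebra.TensorProduct.one_def]
        abel)
    (by
      apply algHom_ext
      · simp [comulHom, counitHom]
      · intro i
        simp [comulHom, counitHom])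
    (by
      apply algHom_ext
      · simp [comulHom, counitHom]
      · intro i
        simp [comulHom, counitHom])

variable {k n}

lemma comul_g : Coalgebra.comul (R := k) (g k n) = g k n ⊗ₜ[k] g k n := by
  change comulHom k n (g k n) = _
  simp [comulHom]

lemma comul_x (i : Fin n) :
    Coalgebra.comul (R := k) (x k i) = x k i ⊗ₜ[k] g k n + 1 ⊗ₜ[k] x k i := by
  change comulHom k n (x k i) = _
  simp [comulHom]

lemma counit_g : Coalgebra.counit (R := k) (g k n) = 1 := by
  change counitHom k n (g k n) = _
  simp [counitHom]

lemma counit_x (i : Fin n) : Coalgebra.counit (R := k) (x k i) = 0 := by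
  change counitHom k n (x k i) = _
  simp [counitHom]

variable (k n) in
/-- The antipode of `E(n)` as a linear map. -/
noncomputable def antipodeLin : EN k n →ₗ[k] EN k n :=
  (MulOpposite.opLinearEquiv k).symm.toLinearMap ∘ₗ (antipodeHom k n).toLinearMap

lemma antipodeLin_one : antipodeLin k n 1 = 1 := by simp [antipodeLin]

lemma antipodeLin_mul (a b : EN k n) :
    antipodeLin k n (a * b) = antipodeLin k n b * antipodeLin k n a := by
  simp [antipodeLin]

lemma antipodeLin_g : antipodeLin k n (g k n) = g k n := by
  simp [antipodeLin, antipodeHom]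

lemma antipodeLin_x (i : Fin n) : antipodeLin k n (x k i) = g k n * x k i := by
  simp [antipodeLin, antipodeHom]

lemma rTensor_mul (t : EN k n ⊗[k] EN k n) (u v : EN k n) :
    LinearMap.mul' k (EN k n) ((antipodeLin k n).rTensor (EN k n) (t * (u ⊗ₜ v))) =
      antipodeLin k n u * LinearMap.mul' k (EN k n) ((antipodeLin k n).rTensor (EN k n) t) * v := by
  induction t with
  | zero => simp
  | tmul a b => simp [antipodeLin_mul, mul_assoc]
  | add a b ha hb => simp only [add_mul, map_add, ha, hb, mul_add]

lemma lTensor_mul (t : EN k n ⊗[k] EN k n) (u v : EN k n) :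
    LinearMap.mul' k (EN k n) ((antipodeLin k n).lTensor (EN k n) ((u ⊗ₜ v) * t)) =
      u * LinearMap.mul' k (EN k n) ((antipodeLin k n).lTensor (EN k n) t) * antipodeLin k n v := by
  induction t with
  | zero => simp
  | tmul a b => simp [antipodeLin_mul, mul_assoc]
  | add a b ha hb => simp only [add_mul, map_add, ha, hb, mul_add]

lemma induction_left {p : EN k n → Prop} (h1 : p 1) (hg : ∀ a, p a → p (g k n * a))
    (hx : ∀ i a, p a → p (x k i * a)) (hadd : ∀ a b, p a → p b → p (a + b))
    (hsmul : ∀ (c : k) a, p a → p (c • a)) (a : EN k n) : p a := by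
  obtain ⟨b, rfl⟩ : ∃ b, mk k n b = a := RingQuot.mkAlgHom_surjective k (ENRel k n) a
  have key : ∀ c, p c → p (mk k n b * c) := by
    induction b using FreeAlgebra.induction with
    | grade0 r =>
      intro c hc
      rw [AlgHom.commutes, ← Algebra.smul_def]
      exact hsmul r c hc
    | grade1 s =>
      intro c hc
      cases s with
      | g => exact hg c hc
      | x i => exact hx i c hc
    | mul a b ha hb =>
      intro c hc
      rw [map_mul, mul_assoc]
      exact ha _ (hb c hc)
    | add a b ha hb =>
      intro c hc
      rw [map_add, add_mul]
      exact hadd _ _ (ha c hc) (hb c hc)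
  simpa using key 1 h1

/-- The canonical Hopf algebra structure of `E(n)`. -/
noncomputable instance instHopfAlgebra : HopfAlgebra k (EN k n) where
  antipode := antipodeLin k n
  mul_antipode_rTensor_comul := by
    ext a
    simp only [LinearMap.comp_apply]
    induction a using induction with
    | h1 => simp [Algebra.TensorProduct.one_def, antipodeLin_one]
    | hg a ha =>
      rw [Bialgebra.comul_mul, Bialgebra.counit_mul, comul_g, rTensor_mul, ha, antipodeLin_g,
        counit_g]
      simp only [Algebra.linearMap_apply, mul_one]
      rw [← Algebra.commutes, mul_assoc, g_mul_g, mul_one]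
    | hx i a ha =>
      rw [Bialgebra.comul_mul, Bialgebra.counit_mul, comul_x, mul_add, map_add, map_add,
        rTensor_mul, rTensor_mul, ha, antipodeLin_x, antipodeLin_one, counit_x]
      simp only [Algebra.linearMap_apply, mul_zero, map_zero, one_mul]
      rw [← Algebra.commutes, mul_assoc, ← mul_add]
      rw [g_mul_x, neg_mul, mul_assoc, g_mul_g]
      simp
    | hadd a b ha hb => simp only [map_add, ha, hb]
    | hsmul c a ha => simp only [map_smul, ha]
  mul_antipode_lTensor_comul := by
    ext a
    simp only [LinearMap.comp_apply]
    induction a using induction_left with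
    | h1 => simp [Algebra.TensorProduct.one_def, antipodeLin_one]
    | hg a ha =>
      rw [Bialgebra.comul_mul, Bialgebra.counit_mul, comul_g, lTensor_mul, ha, antipodeLin_g,
        counit_g]
      simp only [Algebra.linearMap_apply, one_mul]
      rw [← Algebra.commutes, mul_assoc, g_mul_g, mul_one]
    | hx i a ha =>
      rw [Bialgebra.comul_mul, Bialgebra.counit_mul, comul_x, add_mul, map_add, map_add,
        lTensor_mul, lTensor_mul, ha, antipodeLin_g, antipodeLin_x, counit_x]
      simp only [Algebra.linearMap_apply, zero_mul, map_zero, one_mul]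
      rw [← Algebra.commutes, mul_assoc, ← mul_add]
      rw [g_mul_x]
      simp
    | hadd a b ha hb => simp only [map_add, ha, hb]
    | hsmul c a ha => simp only [map_smul, ha]

lemma antipode_g : HopfAlgebra.antipode k (g k n) = g k n := antipodeLin_g

lemma antipode_x (i : Fin n) : HopfAlgebra.antipode k (x k i) = g k n * x k i := antipodeLin_x i

variable (k) in
/-- The ordered monomial `x_P = x_{i_1} ⋯ x_{i_s}` for `P = {i_1 < ⋯ < i_s}`; `x_∅ = 1`. -/
noncomputable def xP (P : Finset (Fin n)) : EN k n := ((P.sort (· ≤ ·)).map (x k)).prod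

end EN

/-! ### Comodule algebras and coinvariants -/

/-- `ρ` makes the algebra `A` a right `H`-comodule algebra
(that is, `ρ` is a right `H`-coaction on `A`). -/
structure IsCoaction {k A H : Type*} [Field k] [Ring A] [Algebra k A] [Ring H] [HopfAlgebra k H]
    (ρ : A →ₗ[k] A ⊗[k] H) : Prop where
  /-- `(ρ ⊗ Id) ρ = (Id ⊗ Δ) ρ` -/
  coassoc : (TensorProduct.assoc k A H H).toLinearMap ∘ₗ ρ.rTensor H ∘ₗ ρ =
    (Coalgebra.comul (R := k) (A := H)).lTensor A ∘ₗ ρ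
  /-- `(Id ⊗ ε) ρ = Id`, under `A ⊗ k ≃ A` -/
  counit : (TensorProduct.rid k A).toLinearMap ∘ₗ
    (Coalgebra.counit (R := k) (A := H)).lTensor A ∘ₗ ρ = LinearMap.id
  map_mul : ∀ a b : A, ρ (a * b) = ρ a * ρ b
  map_one : ρ 1 = 1 ⊗ₜ[k] 1

/-- The space of coinvariants `A^{co H} = {a ∈ A | ρ(a) = a ⊗ 1_H}`. -/
def coinvariants {k A H : Type*} [Field k] [Ring A] [Algebra k A] [Ring H] [HopfAlgebra k H]
    (ρ : A →ₗ[k] A ⊗[k] H) : Submodule k A where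
  carrier := {a | ρ a = a ⊗ₜ[k] 1}
  add_mem' := by
    intro a b ha hb
    simp only [Set.mem_ofPred_eq] at *
    rw [map_add, ha, hb, TensorProduct.add_tmul]
  zero_mem' := by simp
  smul_mem' := by
    intro c a ha
    simp only [Set.mem_ofPred_eq] at *
    rw [map_smul, ha, TensorProduct.smul_tmul']

/-! ### The tuple associated with a coaction of `E(n)` -/

/-- `d` is a `φ`-derivation: `d(ab) = d(a) b + φ(a) d(b)`. -/
def IsSkewDerivation {k A : Type*} [Field k] [Ring A] [Algebra k A]
    (φ : A →ₐ[k] A) (d : A →ₗ[k] A) : Prop :=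
  ∀ a b : A, d (a * b) = d a * b + φ a * d b

/-- The ordered composition `d_P = d_{i_1} ∘ ⋯ ∘ d_{i_s}` for `P = {i_1 < ⋯ < i_s}`;
`d_∅ = Id`. -/
noncomputable def dP {k A : Type*} [Field k] [Ring A] [Algebra k A] {n : ℕ}
    (d : Fin n → (A →ₗ[k] A)) (P : Finset (Fin n)) : Module.End k A :=
  ((P.sort (· ≤ ·)).map d).prod

/-- `(φ, d_1, …, d_n)` is the tuple associated with `ρ : A → A ⊗ E(n)`: `φ` is an involution of
`A`, the `d_i` are pairwise anticommuting `φ`-derivations of square zero that anticommute with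
`φ`, and `ρ` is given by the explicit formula `explicit` in terms of them. -/
structure IsAssociatedTuple {k A : Type*} [Field k] [Ring A] [Algebra k A] {n : ℕ}
    (ρ : A →ₗ[k] A ⊗[k] EN k n) (φ : A →ₐ[k] A) (d : Fin n → (A →ₗ[k] A)) : Prop where
  involution : ∀ a, φ (φ a) = a
  skewDerivation : ∀ i, IsSkewDerivation φ (d i)
  d_sq : ∀ i a, d i (d i a) = 0
  phi_d : ∀ i a, φ (d i a) = -d i (φ a)
  d_d : ∀ i j a, d i (d j a) = -d j (d i a)
  explicit : ∀ a : A, ρ a = ∑ P : Finset (Fin n), (-1 : k) ^ ((P.card + 1) / 2) •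
    (dP d P a ⊗ₜ[k] ((2 : k)⁻¹ • (EN.xP k P + (-1 : k) ^ P.card • (EN.g k n * EN.xP k P))) +
      φ (dP d P a) ⊗ₜ[k]
        ((2 : k)⁻¹ • (EN.xP k P + (-1 : k) ^ (P.card + 1) • (EN.g k n * EN.xP k P))))

/-! ### The endomorphisms of a comodule given by functionals on the coacting Hopf algebra -/

section Coaction

variable {k A H : Type*} [Field k] [Ring A] [Algebra k A] [Ring H] [HopfAlgebra k H]

/-! A coaction turns each functional `f` on `E(n)` into an endomorphism `a ↦ a₀ f(a₁)`, and
coassociativity turns composition into convolution. The tuple is forced: `φ` is the action of the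
character `γ` with `g ↦ -1`, `x_i ↦ 0`, and `d_i` that of the `(γ, ε)`-skew derivation `δ_i` with `g
↦ 0`, `x_j ↦ -δ_{ij}`.

Existence: the relations between `φ` and the `d_i` reduce to identities of functionals. These
follow, on applying `ε`, from the same relations between the endomorphisms `σ` (`signEnd`) and `D_i`
(`skewEnd`) that `γ` and `δ_i` induce on `E(n)` itself, where induction on words proves them. The
explicit formula is one identity in `E(n)`, `id_eq_sum`: the identity map expanded through `ε ∘ D_P`
and `γ ∘ D_P`. It is checked on the elements `x_Q`, `g x_Q`, which need only span.

Uniqueness: applying `γ` or `δ_i` to the explicit formula leaves only the term `P = ∅` or `P = {i}`,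
which returns `φ` or `d_i`. The coinvariants follow from the same evaluations and the formula. -/

/-- The action `a ↦ a₀ f(a₁)` of a functional `f` on a comodule. -/
noncomputable def coactionEnd (ρ : A →ₗ[k] A ⊗[k] H) (f : H →ₗ[k] k) : A →ₗ[k] A :=
  (TensorProduct.rid k A).toLinearMap ∘ₗ f.lTensor A ∘ₗ ρ

lemma coactionEnd_apply (ρ : A →ₗ[k] A ⊗[k] H) (f : H →ₗ[k] k) (a : A) :
    coactionEnd ρ f a = TensorProduct.rid k A (f.lTensor A (ρ a)) := rfl

lemma coactionEnd_neg (ρ : A →ₗ[k] A ⊗[k] H) (f : H →ₗ[k] k) :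
    coactionEnd ρ (-f) = -coactionEnd ρ f := by
  ext a
  simp [coactionEnd_apply, LinearMap.lTensor_neg]

lemma coactionEnd_zero (ρ : A →ₗ[k] A ⊗[k] H) : coactionEnd ρ 0 = 0 := by
  ext a
  simp [coactionEnd_apply]

lemma isCoaction_comul :
    IsCoaction (k := k) (A := H) (Coalgebra.comul (R := k) (A := H)) where
  coassoc := Coalgebra.coassoc
  counit := by
    rw [Coalgebra.lTensor_counit_comp_comul]
    ext a
    simp
  map_mul := Bialgebra.comul_mul
  map_one := by simp [Algebra.TensorProduct.one_def]

/-- The action of a functional on `H` itself, viewed as a comodule over itself. -/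
noncomputable abbrev comulEnd (f : H →ₗ[k] k) : H →ₗ[k] H :=
  coactionEnd (Coalgebra.comul (R := k) (A := H)) f

namespace IsCoaction

variable {ρ : A →ₗ[k] A ⊗[k] H} (hρ : IsCoaction ρ)
include hρ

lemma coactionEnd_counit : coactionEnd ρ (Coalgebra.counit (R := k) (A := H)) = LinearMap.id :=
  hρ.counit

/-- By coassociativity both sides are `a₀ f(a₁) h(a₂)`. -/
lemma coactionEnd_coactionEnd (f h : H →ₗ[k] k) (a : A) :
    coactionEnd ρ f (coactionEnd ρ h a) = coactionEnd ρ (f ∘ₗ comulEnd h) a := by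
  have key : ∀ t : A ⊗[k] H,
      coactionEnd ρ f (TensorProduct.rid k A (h.lTensor A t)) =
        TensorProduct.rid k A ((f ∘ₗ (TensorProduct.rid k H).toLinearMap ∘ₗ
          h.lTensor H).lTensor A (TensorProduct.assoc k A H H (ρ.rTensor H t))) := by
    intro t
    induction t with
    | zero => simp
    | add s t hs ht => simp only [map_add, hs, ht]
    | tmul b c =>
      simp only [LinearMap.lTensor_tmul, TensorProduct.rid_tmul, map_smul, coactionEnd_apply,
        LinearMap.rTensor_tmul]
      induction ρ b with
      | zero => simp
      | add s t hs ht => simp only [map_add, smul_add, TensorProduct.add_tmul, hs, ht]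
      | tmul u v => simp [smul_smul]
  have h2 := congrArg (fun F => F a) hρ.coassoc
  simp only [LinearMap.comp_apply, LinearEquiv.coe_coe] at h2
  rw [coactionEnd_apply ρ h, key, h2, coactionEnd_apply,
    ← LinearMap.comp_apply (LinearMap.lTensor A _), ← LinearMap.lTensor_comp]
  rfl

/-- The coaction as a homomorphism of algebras. -/
noncomputable def toAlgHom : A →ₐ[k] A ⊗[k] H :=
  AlgHom.ofLinearMap ρ (by rw [hρ.map_one, Algebra.TensorProduct.one_def]) hρ.map_mul

/-- The action of a character of `H` on a comodule algebra. -/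
noncomputable def charEnd (γ : H →ₐ[k] k) : A →ₐ[k] A :=
  ((Algebra.TensorProduct.rid k k A).toAlgHom.comp
    (Algebra.TensorProduct.map (AlgHom.id k A) γ)).comp hρ.toAlgHom

lemma charEnd_apply (γ : H →ₐ[k] k) (a : A) :
    hρ.charEnd γ a = coactionEnd ρ γ.toLinearMap a := rfl

/-- Multiplicativity of `ρ` carries the Leibniz rule of `δ` over to `A`, since `ε` acts as the
identity and `γ` as `charEnd`. -/
lemma isSkewDerivation (γ : H →ₐ[k] k) (δ : H →ₗ[k] k)
    (hδ : ∀ u v, δ (u * v) = δ u * Coalgebra.counit (R := k) v + γ u * δ v) :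
    IsSkewDerivation (hρ.charEnd γ) (coactionEnd ρ δ) := by
  have key : ∀ s t : A ⊗[k] H, TensorProduct.rid k A (δ.lTensor A (s * t)) =
      TensorProduct.rid k A (δ.lTensor A s) *
        TensorProduct.rid k A ((Coalgebra.counit (R := k) (A := H)).lTensor A t) +
      TensorProduct.rid k A (γ.toLinearMap.lTensor A s) *
        TensorProduct.rid k A (δ.lTensor A t) := by
    intro s t
    induction s with
    | zero => simp
    | add s s' hs hs' => simp only [add_mul, map_add, hs, hs']; abel
    | tmul a u =>
      induction t with
      | zero => simp
      | add s s' hs hs' => simp only [mul_add, map_add, hs, hs']; abel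
      | tmul b v => simp [hδ, add_smul, smul_smul, mul_comm]
  intro a b
  have hb := congrArg (fun F => F b) hρ.coactionEnd_counit
  simp only [coactionEnd_apply, LinearMap.id_apply] at hb
  rw [charEnd_apply, coactionEnd_apply, hρ.map_mul, key, hb]
  rfl

lemma coactionEnd_comp_list_prod {ι : Type*} (δ : ι → (H →ₗ[k] k)) (l : List ι)
    (f : H →ₗ[k] k) (a : A) :
    coactionEnd ρ (f ∘ₗ ((l.map fun i => comulEnd (δ i)).prod : Module.End k H)) a =
      coactionEnd ρ f (((l.map fun i => coactionEnd ρ (δ i)).prod : Module.End k A) a) := by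
  -- The head of the list is absorbed into `f`, so `f` must vary.
  induction l generalizing f with
  | nil => rfl
  | cons i l ih =>
    simp only [List.map_cons, List.prod_cons, Module.End.mul_apply]
    rw [hρ.coactionEnd_coactionEnd, ← ih]
    rfl

end IsCoaction

end Coaction

/-! ### Monomials, characters and skew derivations of `E(n)` -/

namespace EN

section Basic

variable {k : Type*} [Field k] {n : ℕ}

/-! ### Ordered monomials span `E(n)`. -/

variable (k) in
/-- The product `x_{i_1} ⋯ x_{i_s}` for a list of indices. -/
noncomputable def xL (l : List (Fin n)) : EN k n := (l.map (x k)).prod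

@[simp] lemma xL_nil : xL k ([] : List (Fin n)) = 1 := rfl

@[simp] lemma xL_cons (i : Fin n) (l : List (Fin n)) : xL k (i :: l) = x k i * xL k l := by
  simp [xL]

lemma xL_append_singleton (l : List (Fin n)) (i : Fin n) :
    xL k (l ++ [i]) = xL k l * x k i := by
  simp [xL]

lemma xP_eq_xL (P : Finset (Fin n)) : xP k P = xL k (P.sort (· ≤ ·)) := rfl

lemma exists_xL_eq_x_mul {i : Fin n} {l : List (Fin n)} (h : i ∈ l) :
    ∃ v, xL k l = x k i * v := by
  induction l with
  | nil => simp at h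
  | cons j l ih =>
    rcases List.mem_cons.1 h with rfl | h
    · exact ⟨_, xL_cons _ _⟩
    · obtain ⟨v, hv⟩ := ih h
      exact ⟨-(x k j * v), by
        rw [xL_cons, hv, ← mul_assoc, x_mul_x', neg_mul, mul_assoc, mul_neg]⟩

/-- The scalar is a sign, but a spanning argument does not need its value. -/
lemma exists_xL_eq_smul_of_perm {l m : List (Fin n)} (h : l.Perm m) :
    ∃ c : k, xL k l = c • xL k m := by
  induction h with
  | nil => exact ⟨1, by simp⟩
  | cons i _ ih =>
    obtain ⟨c, hc⟩ := ih
    exact ⟨c, by simp [hc]⟩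
  | swap i j l => exact ⟨-1, by simp [← mul_assoc, x_mul_x' j i]⟩
  | trans _ _ ih ih' =>
    obtain ⟨c, hc⟩ := ih
    obtain ⟨c', hc'⟩ := ih'
    exact ⟨c * c', by rw [hc, hc', smul_smul]⟩

variable (k n) in
/-- The span of the monomials `x_P` and `g x_P`. -/
noncomputable def monomialSpan : Submodule k (EN k n) :=
  Submodule.span k (Set.range (xP k) ∪ Set.range fun P => g k n * xP k P)

lemma xP_mem_monomialSpan (P : Finset (Fin n)) : xP k P ∈ monomialSpan k n :=
  Submodule.subset_span (Or.inl ⟨P, rfl⟩)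

lemma g_mul_xP_mem_monomialSpan (P : Finset (Fin n)) : g k n * xP k P ∈ monomialSpan k n :=
  Submodule.subset_span (Or.inr ⟨P, rfl⟩)

lemma exists_x_mul_xP (i : Fin n) (P : Finset (Fin n)) :
    ∃ (c : k) (Q : Finset (Fin n)), x k i * xP k P = c • xP k Q := by
  by_cases hi : i ∈ P
  · obtain ⟨v, hv⟩ := exists_xL_eq_x_mul (k := k) (i := i) (l := P.sort (· ≤ ·)) (by simpa)
    exact ⟨0, ∅, by rw [xP_eq_xL, hv, ← mul_assoc, x_mul_x, zero_mul, zero_smul]⟩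
  · have hp : (i :: P.sort (· ≤ ·)).Perm ((insert i P).sort (· ≤ ·)) := by
      rw [List.perm_ext_iff_of_nodup (by simpa using hi) (Finset.sort_nodup _ _)]
      simp
    obtain ⟨c, hc⟩ := exists_xL_eq_smul_of_perm (k := k) hp
    exact ⟨c, insert i P, by rw [xP_eq_xL, ← xL_cons, hc, xP_eq_xL]⟩

/-- The span contains `1` and is stable under left multiplication by the generators; `x_i g = -g
x_i` handles the monomials `g x_P`. -/
lemma monomialSpan_eq_top : monomialSpan k n = ⊤ := by
  refine eq_top_iff.2 fun u _ => ?_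
  induction u using induction_left with
  | h1 => simpa [xP] using xP_mem_monomialSpan (k := k) (∅ : Finset (Fin n))
  | hadd a b ha hb => exact add_mem (ha trivial) (hb trivial)
  | hsmul c a ha => exact Submodule.smul_mem _ c (ha trivial)
  | hg a ha =>
    refine Submodule.span_induction (p := fun a _ => g k n * a ∈ monomialSpan k n)
      ?_ (by simp) (fun a b _ _ ha hb => by rw [mul_add]; exact add_mem ha hb)
      (fun c a _ ha => by rw [mul_smul_comm]; exact Submodule.smul_mem _ c ha) (ha trivial)
    rintro _ (⟨P, rfl⟩ | ⟨P, rfl⟩)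
    · exact g_mul_xP_mem_monomialSpan P
    · rw [← mul_assoc, g_mul_g, one_mul]
      exact xP_mem_monomialSpan P
  | hx i a ha =>
    refine Submodule.span_induction (p := fun a _ => x k i * a ∈ monomialSpan k n)
      ?_ (by simp) (fun a b _ _ ha hb => by rw [mul_add]; exact add_mem ha hb)
      (fun c a _ ha => by rw [mul_smul_comm]; exact Submodule.smul_mem _ c ha) (ha trivial)
    rintro _ (⟨P, rfl⟩ | ⟨P, rfl⟩)
    · obtain ⟨c, Q, h⟩ := exists_x_mul_xP (k := k) i P
      rw [h]
      exact Submodule.smul_mem _ c (xP_mem_monomialSpan Q)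
    · obtain ⟨c, Q, h⟩ := exists_x_mul_xP (k := k) i P
      rw [← mul_assoc, ← neg_eq_iff_eq_neg.2 (g_mul_x i), neg_mul, mul_assoc, h, mul_smul_comm]
      exact neg_mem (Submodule.smul_mem _ c (g_mul_xP_mem_monomialSpan Q))

lemma linearMap_ext {M : Type*} [AddCommGroup M] [Module k M] {F F' : EN k n →ₗ[k] M}
    (h : ∀ P, F (xP k P) = F' (xP k P))
    (hg : ∀ P, F (g k n * xP k P) = F' (g k n * xP k P)) : F = F' := by
  refine LinearMap.ext_on (monomialSpan_eq_top (k := k) (n := n)) ?_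
  rintro _ (⟨P, rfl⟩ | ⟨P, rfl⟩)
  · exact h P
  · exact hg P

/-! ### The functionals `γ` and `δ_i`. -/

variable (k n) in
/-- The character of `E(n)` with `g ↦ -1` and `x_i ↦ 0`. -/
noncomputable def signChar : EN k n →ₐ[k] k :=
  lift (-1) (fun _ => 0) (by simp) (by simp) (by simp) (by simp)

@[simp] lemma signChar_g : signChar k n (g k n) = -1 := by simp [signChar]

@[simp] lemma signChar_x (i : Fin n) : signChar k n (x k i) = 0 := by simp [signChar]

/-- The representation of `E(n)` by upper triangular matrices with `g ↦ diag(-1, 1)` and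
`x_j ↦ -δ_{ij} e_{12}`. -/
noncomputable def triangularRep (i : Fin n) : EN k n →ₐ[k] Matrix (Fin 2) (Fin 2) k :=
  lift !![-1, 0; 0, 1] (fun j => !![0, if j = i then -1 else 0; 0, 0])
    (by simp [Matrix.one_fin_two])
    (by intro j; ext a b; fin_cases a <;> fin_cases b <;> simp [Matrix.mul_apply])
    (by intro j; split_ifs <;> simp)
    (by intro j l _; ext a b; split_ifs <;> fin_cases a <;> fin_cases b <;> simp)

/-- The diagonal carries the two characters `γ` and `ε`, so multiplicativity of the remaining entry
is exactly the skew Leibniz rule; this is how `δ_i` is well defined. -/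
lemma triangularRep_entries (i : Fin n) (u : EN k n) :
    triangularRep i u 0 0 = signChar k n u ∧ triangularRep i u 1 0 = 0 ∧
      triangularRep i u 1 1 = Coalgebra.counit (R := k) u := by
  induction u using induction with
  | h1 => simp
  | hg a ha => simp [triangularRep, Matrix.mul_apply, counit_g] at ha ⊢; simp [ha]
  | hx j a ha => simp [triangularRep, Matrix.mul_apply, counit_x] at ha ⊢; simp [ha]
  | hadd a b ha hb => simp [ha, hb]
  | hsmul c a ha => simp [ha]

variable (k) in
/-- The skew derivation `E(n) → k` with `g ↦ 0` and `x_j ↦ -δ_{ij}`. -/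
noncomputable def skewFunctional (i : Fin n) : EN k n →ₗ[k] k :=
  Matrix.entryLinearMap k k 0 1 ∘ₗ (triangularRep i).toLinearMap

lemma skewFunctional_mul (i : Fin n) (u v : EN k n) :
    skewFunctional k i (u * v) = skewFunctional k i u * Coalgebra.counit (R := k) v +
      signChar k n u * skewFunctional k i v := by
  simp [skewFunctional, Matrix.mul_apply, triangularRep_entries]
  ring

@[simp] lemma skewFunctional_g (i : Fin n) : skewFunctional k i (g k n) = 0 := by
  simp [skewFunctional, triangularRep]

@[simp] lemma skewFunctional_x (i j : Fin n) :
    skewFunctional k i (x k j) = if j = i then -1 else 0 := by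
  simp [skewFunctional, triangularRep]

@[simp] lemma skewFunctional_one (i : Fin n) : skewFunctional k i (1 : EN k n) = 0 := by
  simp [skewFunctional]

/-! ### The induced endomorphisms of `E(n)` and their relations. -/

variable (k n) in
/-- The automorphism of `E(n)` with `g ↦ -g` and `x_i ↦ -x_i`. -/
noncomputable def signEnd : EN k n →ₐ[k] EN k n :=
  (isCoaction_comul (k := k) (H := EN k n)).charEnd (signChar k n)

variable (k) in
/-- The skew derivation of `E(n)` with `g ↦ 0` and `x_j ↦ -δ_{ij}`. -/
noncomputable def skewEnd (i : Fin n) : EN k n →ₗ[k] EN k n := comulEnd (skewFunctional k i)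

@[simp] lemma signEnd_g : signEnd k n (g k n) = -g k n := by
  simp [signEnd, IsCoaction.charEnd_apply, coactionEnd_apply, comul_g]

@[simp] lemma signEnd_x (i : Fin n) : signEnd k n (x k i) = -x k i := by
  simp [signEnd, IsCoaction.charEnd_apply, coactionEnd_apply, comul_x]

lemma skewEnd_mul (i : Fin n) (u v : EN k n) :
    skewEnd k i (u * v) = skewEnd k i u * v + signEnd k n u * skewEnd k i v :=
  (isCoaction_comul (k := k) (H := EN k n)).isSkewDerivation _ _ (skewFunctional_mul i) u v

@[simp] lemma skewEnd_one (i : Fin n) : skewEnd k i (1 : EN k n) = 0 := by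
  simp [skewEnd, coactionEnd_apply, Algebra.TensorProduct.one_def]

@[simp] lemma skewEnd_g (i : Fin n) : skewEnd k i (g k n) = 0 := by
  simp [skewEnd, coactionEnd_apply, comul_g]

@[simp] lemma skewEnd_x (i j : Fin n) :
    skewEnd k i (x k j) = if j = i then -1 else 0 := by
  simp [skewEnd, coactionEnd_apply, comul_x]

/-- With `counit_skewEnd`, this recovers functionals from their endomorphisms, so identities of
endomorphisms yield identities of convolution products. -/
lemma counit_signEnd (u : EN k n) :
    Coalgebra.counit (R := k) (signEnd k n u) = signChar k n u := by
  have : (Bialgebra.counitAlgHom k (EN k n)).comp (signEnd k n) = signChar k n := by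
    apply algHom_ext <;> simp [counit_g, counit_x]
  exact congrArg (fun F => F u) this

lemma counit_skewEnd (i : Fin n) (u : EN k n) :
    Coalgebra.counit (R := k) (skewEnd k i u) = skewFunctional k i u := by
  induction u using induction with
  | h1 => simp
  | hg a ha => simp [skewEnd_mul, skewFunctional_mul, ha, counit_g]
  | hx j a ha =>
    simp only [skewEnd_mul, skewFunctional_mul, map_add, Bialgebra.counit_mul, ha, counit_x,
      counit_signEnd, skewEnd_x, skewFunctional_x]
    split_ifs <;> simp
  | hadd a b ha hb => simp only [map_add, ha, hb]
  | hsmul c a ha => simp [ha]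

lemma signEnd_signEnd (u : EN k n) : signEnd k n (signEnd k n u) = u := by
  have : (signEnd k n).comp (signEnd k n) = AlgHom.id k _ := by
    apply algHom_ext <;> simp
  exact congrArg (fun F => F u) this

lemma signEnd_skewEnd (i : Fin n) (u : EN k n) :
    signEnd k n (skewEnd k i u) = -skewEnd k i (signEnd k n u) := by
  induction u using induction with
  | h1 => simp
  | hg a ha => simp [skewEnd_mul, ha]
  | hx j a ha =>
    simp only [skewEnd_mul, map_add, map_mul, ha, signEnd_x, skewEnd_x, map_neg]
    split_ifs <;> simp [add_comm]
  | hadd a b ha hb => simp only [map_add, ha, hb, neg_add]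
  | hsmul c a ha => simp [ha]

lemma skewEnd_skewEnd (i j : Fin n) (u : EN k n) :
    skewEnd k i (skewEnd k j u) = -skewEnd k j (skewEnd k i u) := by
  induction u using induction with
  | h1 => simp
  | hg a ha => simp [skewEnd_mul, ha]
  | hx l a ha =>
    simp only [skewEnd_mul, map_add, ha, skewEnd_x, signEnd_skewEnd]
    split_ifs <;> simp <;> abel
  | hadd a b ha hb => simp only [map_add, ha, hb, neg_add]
  | hsmul c a ha => simp [ha]

lemma skewEnd_skewEnd_self (i : Fin n) (u : EN k n) : skewEnd k i (skewEnd k i u) = 0 := by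
  induction u using induction with
  | h1 => simp
  | hg a ha => simp [skewEnd_mul, ha]
  | hx l a ha =>
    simp only [skewEnd_mul, map_add, ha, skewEnd_x, signEnd_skewEnd]
    split_ifs <;> simp
  | hadd a b ha hb => simp only [map_add, ha, hb, add_zero]
  | hsmul c a ha => simp [ha]

/-! ### Iterated skew derivations on monomials. -/

variable (k) in
/-- The composition `D_{i_1} ∘ ⋯ ∘ D_{i_s}` of skew derivations for a list of indices. -/
noncomputable def skewEndL (l : List (Fin n)) : Module.End k (EN k n) :=
  (l.map fun i => comulEnd (skewFunctional k i)).prod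

@[simp] lemma skewEndL_nil (u : EN k n) : skewEndL k [] u = u := rfl

@[simp] lemma skewEndL_cons (i : Fin n) (l : List (Fin n)) (u : EN k n) :
    skewEndL k (i :: l) u = skewEnd k i (skewEndL k l u) := by
  simp [skewEndL, skewEnd]

lemma skewEndL_append_singleton (l : List (Fin n)) (i : Fin n) (u : EN k n) :
    skewEndL k (l ++ [i]) u = skewEndL k l (skewEnd k i u) := by
  simp [skewEndL, skewEnd]

lemma skewEnd_xL_of_notMem {i : Fin n} {l : List (Fin n)} (h : i ∉ l) :
    skewEnd k i (xL k l) = 0 := by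
  induction l with
  | nil => simp
  | cons j l ih =>
    simp only [List.mem_cons, not_or] at h
    simp [skewEnd_mul, ih h.2, Ne.symm h.1]

lemma skewEnd_skewEndL {i : Fin n} {u : EN k n} (h : skewEnd k i u = 0) (l : List (Fin n)) :
    skewEnd k i (skewEndL k l u) = 0 := by
  induction l with
  | nil => simpa
  | cons j l ih => rw [skewEndL_cons, skewEnd_skewEnd, ih, map_zero, neg_zero]

lemma skewEndL_eq_zero {i : Fin n} {u : EN k n} (h : skewEnd k i u = 0) {l : List (Fin n)}
    (hl : i ∈ l) : skewEndL k l u = 0 := by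
  induction l with
  | nil => simp at hl
  | cons j l ih =>
    rcases List.mem_cons.1 hl with rfl | hl
    · rw [skewEndL_cons, skewEnd_skewEndL h]
    · rw [skewEndL_cons, ih hl, map_zero]

/-- For `j ≠ i`, `D_j` kills `x_i` and `σ` only changes its sign, so the left factor `x_i` survives.
-/
lemma exists_skewEndL_x_mul {i : Fin n} {l : List (Fin n)} (hl : i ∉ l) (u : EN k n) :
    ∃ v, skewEndL k l (x k i * u) = x k i * v := by
  induction l with
  | nil => exact ⟨u, rfl⟩
  | cons j l ih =>
    simp only [List.mem_cons, not_or] at hl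
    obtain ⟨v, hv⟩ := ih hl.2
    exact ⟨-skewEnd k j v, by simp [hv, skewEnd_mul, hl.1]⟩

lemma skewEndL_g_mul (l : List (Fin n)) (u : EN k n) :
    skewEndL k l (g k n * u) = (-1 : k) ^ l.length • (g k n * skewEndL k l u) := by
  induction l with
  | nil => simp
  | cons i l ih => simp [ih, skewEnd_mul, pow_succ]

lemma signEnd_xL (l : List (Fin n)) :
    signEnd k n (xL k l) = (-1 : k) ^ l.length • xL k l := by
  induction l with
  | nil => simp
  | cons i l ih => simp [ih, pow_succ]

/-- The recursion for the signs produced by removing one letter in `skewEndL_xL`. -/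
lemma neg_one_pow_half_succ (s : ℕ) :
    (-1 : k) ^ ((s + 1 + 1) / 2) = -((-1) ^ s * (-1) ^ ((s + 1) / 2)) := by
  obtain ⟨m, rfl⟩ | ⟨m, rfl⟩ := s.even_or_odd
  · rw [show (m + m + 1 + 1) / 2 = m + 1 by omega, show (m + m + 1) / 2 = m by omega]
    simp [pow_succ]
  · rw [show (2 * m + 1 + 1 + 1) / 2 = m + 1 by omega, show (2 * m + 1 + 1) / 2 = m + 1 by omega]
    simp [pow_succ, pow_mul]

/-- Peeling off the last letter, `D_i` kills `x_l`, so `D_i(x_l x_i) = σ(x_l) D_i(x_i) = -(-1)^s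
x_l` with `s` the length of `l`. This is the source of the exponent `⌊(|P|+1)/2⌋`. -/
lemma skewEndL_xL {l : List (Fin n)} (hl : l.Nodup) :
    skewEndL k l (xL k l) = (-1 : k) ^ ((l.length + 1) / 2) • (1 : EN k n) := by
  induction l using List.reverseRecOn with
  | nil => simp
  | append_singleton l i ih =>
    have hl' : l.Nodup ∧ i ∉ l := by
      rw [List.nodup_append] at hl
      exact ⟨hl.1, fun h => hl.2.2 i h i (by simp) rfl⟩
    rw [skewEndL_append_singleton, xL_append_singleton, skewEnd_mul, skewEnd_xL_of_notMem hl'.2,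
      signEnd_xL, List.length_append, List.length_singleton, neg_one_pow_half_succ]
    simp [ih hl'.1, smul_smul]

/-- An index in `Q \ P` leaves a left factor `x_i`, which `f` kills; an index in `P \ Q` gives a
`D_i` that kills `x_Q` and can be anticommuted to act first. -/
lemma algHom_skewEndL_xL_of_ne (f : EN k n →ₐ[k] k) (hf : ∀ i, f (x k i) = 0)
    {P Q : Finset (Fin n)} (h : P ≠ Q) :
    f (skewEndL k (P.sort (· ≤ ·)) (xP k Q)) = 0 := by
  by_cases hPQ : P ⊆ Q
  · obtain ⟨i, hiQ, hiP⟩ := Finset.exists_of_ssubset (hPQ.ssubset_of_ne h)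
    obtain ⟨v, hv⟩ := exists_xL_eq_x_mul (k := k) (i := i) (l := Q.sort (· ≤ ·)) (by simpa)
    obtain ⟨w, hw⟩ := exists_skewEndL_x_mul (k := k) (i := i) (l := P.sort (· ≤ ·))
      (by simpa) v
    rw [xP_eq_xL, hv, hw, map_mul, hf, zero_mul]
  · obtain ⟨i, hiP, hiQ⟩ := Finset.not_subset.1 hPQ
    rw [xP_eq_xL, skewEndL_eq_zero (i := i) (skewEnd_xL_of_notMem (by simpa)) (by simpa), map_zero]

lemma algHom_skewEndL_xP (f : EN k n →ₐ[k] k) (hf : ∀ i, f (x k i) = 0)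
    (P Q : Finset (Fin n)) :
    f (skewEndL k (P.sort (· ≤ ·)) (xP k Q)) =
      if P = Q then (-1 : k) ^ ((Q.card + 1) / 2) else 0 := by
  split_ifs with h
  · subst h
    rw [xP_eq_xL, skewEndL_xL (Finset.sort_nodup _ _)]
    simp
  · exact algHom_skewEndL_xL_of_ne f hf h

lemma algHom_skewEndL_g_mul_xP (f : EN k n →ₐ[k] k) (hf : ∀ i, f (x k i) = 0)
    (P Q : Finset (Fin n)) :
    f (skewEndL k (P.sort (· ≤ ·)) (g k n * xP k Q)) =
      if P = Q then (-1 : k) ^ Q.card * (f (g k n) * (-1 : k) ^ ((Q.card + 1) / 2)) else 0 := by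
  rw [skewEndL_g_mul, map_smul, map_mul, algHom_skewEndL_xP f hf, Finset.length_sort]
  split_ifs with h <;> simp [h]

/-! ### Expansion of the identity of `E(n)`. -/

variable (k) in
/-- The element `(x_P + (-1)^m g x_P) / 2`. -/
noncomputable def halfSum (P : Finset (Fin n)) (m : ℕ) : EN k n :=
  (2 : k)⁻¹ • (xP k P + (-1 : k) ^ m • (g k n * xP k P))

lemma halfSum_add_halfSum (h2 : (2 : k) ≠ 0) (P : Finset (Fin n)) :
    halfSum k P P.card + halfSum k P (P.card + 1) = xP k P := by
  rw [halfSum, halfSum, ← smul_add, pow_succ, mul_neg_one, neg_smul]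
  rw [show ∀ a b : EN k n, a + b + (a + -b) = (2 : k) • a by intro a b; rw [two_smul]; abel,
    smul_smul, inv_mul_cancel₀ h2, one_smul]

lemma halfSum_sub_halfSum (h2 : (2 : k) ≠ 0) (P : Finset (Fin n)) :
    halfSum k P P.card - halfSum k P (P.card + 1) = (-1 : k) ^ P.card • (g k n * xP k P) := by
  rw [halfSum, halfSum, ← smul_sub, pow_succ, mul_neg_one, neg_smul]
  rw [show ∀ a b : EN k n, a + b - (a + -b) = (2 : k) • b by intro a b; rw [two_smul]; abel,
    smul_smul, inv_mul_cancel₀ h2, one_smul]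

/-- Expansion of an element of `E(n)` through the functionals `ε ∘ D_P` and `γ ∘ D_P`. -/
lemma id_eq_sum (h2 : (2 : k) ≠ 0) : (LinearMap.id : EN k n →ₗ[k] EN k n) =
    ∑ P : Finset (Fin n), (-1 : k) ^ ((P.card + 1) / 2) •
      ((Coalgebra.counit (R := k) ∘ₗ skewEndL k (P.sort (· ≤ ·))).smulRight (halfSum k P P.card) +
        ((signChar k n).toLinearMap ∘ₗ skewEndL k (P.sort (· ≤ ·))).smulRight
          (halfSum k P (P.card + 1))) := by
  have hsq : ∀ m : ℕ, (-1 : k) ^ m * (-1) ^ m = 1 := fun m => by rw [← mul_pow]; simp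
  have e1 := algHom_skewEndL_xP (Bialgebra.counitAlgHom k (EN k n)) counit_x
  have e2 := algHom_skewEndL_g_mul_xP (Bialgebra.counitAlgHom k (EN k n)) counit_x
  simp only [Bialgebra.counitAlgHom_apply, counit_g] at e1 e2
  refine linearMap_ext (fun Q => ?_) (fun Q => ?_)
  · simp only [LinearMap.id_apply, LinearMap.sum_apply, LinearMap.smul_apply, LinearMap.add_apply,
      LinearMap.smulRight_apply, LinearMap.comp_apply, AlgHom.toLinearMap_apply, e1,
      algHom_skewEndL_xP _ signChar_x]
    rw [Finset.sum_eq_single Q (fun P _ h => by simp [h]) (by simp)]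
    simp only [if_true]
    -- On `x_Q` the two functionals agree, so the halves add.
    rw [← smul_add, smul_smul, hsq, one_smul, halfSum_add_halfSum h2]
  · simp only [LinearMap.id_apply, LinearMap.sum_apply, LinearMap.smul_apply, LinearMap.add_apply,
      LinearMap.smulRight_apply, LinearMap.comp_apply, AlgHom.toLinearMap_apply, e2,
      algHom_skewEndL_g_mul_xP _ signChar_x, signChar_g]
    rw [Finset.sum_eq_single Q (fun P _ h => by simp [h]) (by simp)]
    simp only [if_true, one_mul, neg_mul, mul_neg, neg_smul]
    -- On `g x_Q` they differ by the sign `γ(g) = -1`, so the halves subtract.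
    rw [← sub_eq_add_neg, ← smul_sub, halfSum_sub_halfSum h2, smul_smul, smul_smul, mul_left_comm,
      hsq, mul_one, hsq, one_smul]

end Basic

/-! ### Values of the functionals on monomials -/

section Values

variable {k : Type*} [Field k] {n : ℕ}

lemma algHom_xP (f : EN k n →ₐ[k] k) (hf : ∀ i, f (x k i) = 0) (P : Finset (Fin n)) :
    f (xP k P) = if P = ∅ then 1 else 0 := by
  split_ifs with h
  · subst h
    simp [xP]
  · obtain ⟨i, hi⟩ := Finset.nonempty_iff_ne_empty.2 h
    obtain ⟨v, hv⟩ := exists_xL_eq_x_mul (k := k) (i := i) (l := P.sort (· ≤ ·)) (by simpa)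
    rw [xP_eq_xL, hv, map_mul, hf, zero_mul]

/-- This is the case of a one-element set of derivations, because `ε ∘ D_i = δ_i`. -/
lemma skewFunctional_xP (i : Fin n) (P : Finset (Fin n)) :
    skewFunctional k i (xP k P) = if P = {i} then -1 else 0 := by
  have h := algHom_skewEndL_xP (Bialgebra.counitAlgHom k (EN k n)) counit_x {i} P
  simp only [Finset.sort_singleton, skewEndL_cons, skewEndL_nil, Bialgebra.counitAlgHom_apply,
    counit_skewEnd] at h
  rw [h]
  simp only [eq_comm (a := P)]
  split_ifs with hP
  · simp [← hP]
  · rfl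

end Values

end EN

/-! ### The tuple associated with a coaction of `E(n)` -/

section Tuple

open EN

variable {k A : Type*} [Field k] [Ring A] [Algebra k A] {n : ℕ} {ρ : A →ₗ[k] A ⊗[k] EN k n}

lemma IsCoaction.isAssociatedTuple (h2 : (2 : k) ≠ 0) (hρ : IsCoaction ρ) :
    IsAssociatedTuple ρ (hρ.charEnd (signChar k n))
      (fun i => coactionEnd ρ (skewFunctional k i)) where
  involution a := by
    rw [hρ.charEnd_apply, hρ.charEnd_apply, hρ.coactionEnd_coactionEnd]
    have : (signChar k n).toLinearMap ∘ₗ comulEnd (signChar k n).toLinearMap =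
        Coalgebra.counit := by
      ext u
      have := counit_signEnd (signEnd k n u)
      rw [signEnd_signEnd] at this
      exact this.symm
    rw [this, hρ.coactionEnd_counit]
    rfl
  skewDerivation i := hρ.isSkewDerivation _ _ (skewFunctional_mul i)
  d_sq i a := by
    rw [hρ.coactionEnd_coactionEnd]
    have : skewFunctional k i ∘ₗ comulEnd (skewFunctional k i) = 0 := by
      ext u
      have := counit_skewEnd i (skewEnd k i u)
      rw [skewEnd_skewEnd_self, map_zero] at this
      exact this.symm
    rw [this, coactionEnd_zero]
    rfl
  phi_d i a := by
    rw [hρ.charEnd_apply, hρ.charEnd_apply, hρ.coactionEnd_coactionEnd,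
      hρ.coactionEnd_coactionEnd]
    have : (signChar k n).toLinearMap ∘ₗ comulEnd (skewFunctional k i) =
        -(skewFunctional k i ∘ₗ comulEnd (signChar k n).toLinearMap) := by
      ext u
      have := counit_signEnd (skewEnd k i u)
      rw [signEnd_skewEnd, map_neg, counit_skewEnd] at this
      exact this.symm
    rw [this, coactionEnd_neg]
    rfl
  d_d i j a := by
    rw [hρ.coactionEnd_coactionEnd, hρ.coactionEnd_coactionEnd]
    have : skewFunctional k i ∘ₗ comulEnd (skewFunctional k j) =
        -(skewFunctional k j ∘ₗ comulEnd (skewFunctional k i)) := by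
      ext u
      have := counit_skewEnd i (skewEnd k j u)
      rw [skewEnd_skewEnd, map_neg, counit_skewEnd] at this
      exact this.symm
    rw [this, coactionEnd_neg]
    rfl
  explicit a := by
    have key : ∀ (f : EN k n →ₗ[k] k) (e : EN k n) (t : A ⊗[k] EN k n),
        (f.smulRight e).lTensor A t = TensorProduct.rid k A (f.lTensor A t) ⊗ₜ[k] e := by
      intro f e t
      induction t with
      | zero => simp
      | add s t hs ht => simp only [map_add, hs, ht, TensorProduct.add_tmul]
      | tmul b u => simp [TensorProduct.smul_tmul]
    -- The expansion of the identity is applied to the second leg of `ρ a`.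
    have h := congrArg (fun F => F.lTensor A (ρ a)) (id_eq_sum (k := k) (n := n) h2)
    simp only [LinearMap.lTensor_id, LinearMap.id_apply] at h
    rw [h, ← LinearMap.coe_lTensorHom, map_sum, LinearMap.sum_apply]
    refine Finset.sum_congr rfl fun P _ => ?_
    simp only [map_smul, map_add, LinearMap.coe_lTensorHom, LinearMap.smul_apply,
      LinearMap.add_apply, key, ← coactionEnd_apply]
    rw [skewEndL, hρ.coactionEnd_comp_list_prod, hρ.coactionEnd_comp_list_prod,
      hρ.coactionEnd_counit]
    rfl

/-! ### Uniqueness and coinvariants from the explicit formula. -/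

namespace IsAssociatedTuple

variable {φ : A →ₐ[k] A} {d : Fin n → (A →ₗ[k] A)} (h : IsAssociatedTuple ρ φ d)
include h

lemma coactionEnd_eq_sum (f : EN k n →ₗ[k] k) (a : A) :
    coactionEnd ρ f a = ∑ P : Finset (Fin n), (-1 : k) ^ ((P.card + 1) / 2) •
      (f (halfSum k P P.card) • dP d P a + f (halfSum k P (P.card + 1)) • φ (dP d P a)) := by
  rw [coactionEnd_apply, h.explicit]
  simp only [map_sum, map_smul, map_add, LinearMap.lTensor_tmul, TensorProduct.rid_tmul, halfSum]

lemma phi_eq (h2 : (2 : k) ≠ 0) (a : A) :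
    φ a = coactionEnd ρ (signChar k n).toLinearMap a := by
  rw [h.coactionEnd_eq_sum, Finset.sum_eq_single ∅]
  -- Here `γ((1+g)/2) = 0` and `γ((1-g)/2) = 1`, so only `φ a` remains.
  · have : (2 : k)⁻¹ + 2⁻¹ = 1 := by rw [← two_mul, mul_inv_cancel₀ h2]
    simp [halfSum, algHom_xP _ signChar_x, dP, this]
  · intro P _ hP
    simp [halfSum, algHom_xP _ signChar_x, hP]
  · simp

lemma d_eq (h2 : (2 : k) ≠ 0) (i : Fin n) (a : A) :
    d i a = coactionEnd ρ (skewFunctional k i) a := by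
  rw [h.coactionEnd_eq_sum, Finset.sum_eq_single {i}]
  -- Here `δ_i((x_i - g x_i)/2) = -1` cancels the sign of the term, and `δ_i((x_i + g x_i)/2) = 0`.
  · have : -(2 : k)⁻¹ + -2⁻¹ = -1 := by
      rw [← neg_add, ← two_mul, mul_inv_cancel₀ h2]
    simp [halfSum, skewFunctional_mul, skewFunctional_xP, dP, this]
  · intro P _ hP
    simp [halfSum, skewFunctional_mul, skewFunctional_xP, hP]
  · simp

lemma coinvariants_eq (h2 : (2 : k) ≠ 0) : coinvariants ρ =
    LinearMap.ker (φ.toLinearMap - LinearMap.id) ⊓ ⨅ i : Fin n, LinearMap.ker (d i) := by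
  ext a
  simp only [Submodule.mem_inf, Submodule.mem_iInf, LinearMap.mem_ker, LinearMap.sub_apply,
    AlgHom.toLinearMap_apply, LinearMap.id_apply, sub_eq_zero]
  change ρ a = a ⊗ₜ[k] 1 ↔ _
  constructor
  · intro ha
    refine ⟨?_, fun i => ?_⟩
    · rw [h.phi_eq h2, coactionEnd_apply, ha]
      simp
    · rw [h.d_eq h2, coactionEnd_apply, ha]
      simp
  · rintro ⟨hφ, hd⟩
    have hdP : ∀ P : Finset (Fin n), P ≠ ∅ → dP d P a = 0 := by
      intro P hP
      have hl : P.sort (· ≤ ·) ≠ [] := by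
        intro h0
        have := congrArg List.length h0
        simp at this
        exact hP this
      -- The last factor of the composition acts first, and it kills `a`.
      rw [dP, ← List.dropLast_append_getLast hl]
      simp [hd]
    rw [h.explicit, Finset.sum_eq_single ∅ (fun P _ hP => by simp [hdP P hP]) (by simp)]
    have := halfSum_add_halfSum h2 (∅ : Finset (Fin n))
    simp only [halfSum] at this
    simp only [dP, Finset.sort_empty, List.map_nil, List.prod_nil, Module.End.one_apply, hφ]
    rw [← TensorProduct.tmul_add, this]
    simp [xP]

end IsAssociatedTuple

end Tuple

theorem proposition4p6 {k A : Type*} [Field k] (hk : ringChar k ≠ 2)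
    [Ring A] [Algebra k A] [FiniteDimensional k A] (n : ℕ)
    (ρ : A →ₗ[k] A ⊗[k] EN k n) (hρ : IsCoaction ρ) :
    (∃! t : (A →ₐ[k] A) × (Fin n → (A →ₗ[k] A)), IsAssociatedTuple ρ t.1 t.2) ∧
    ∀ (φ : A →ₐ[k] A) (d : Fin n → (A →ₗ[k] A)), IsAssociatedTuple ρ φ d →
      coinvariants ρ =
        LinearMap.ker (φ.toLinearMap - LinearMap.id) ⊓ ⨅ i : Fin n, LinearMap.ker (d i) := by
  have h2 : (2 : k) ≠ 0 := Ring.two_ne_zero hk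
  refine ⟨⟨(_, _), hρ.isAssociatedTuple h2, ?_⟩, fun φ d h => h.coinvariants_eq h2⟩
  rintro ⟨φ, d⟩ h
  refine Prod.ext (AlgHom.ext fun a => h.phi_eq h2 a) ?_
  funext i
  exact LinearMap.ext fun a => h.d_eq h2 i a
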